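/- For a nonzero complex number $q$, let $C(U_q(2))$ be the universal unital $C^*$-algebra generated by elements $a,b,D$ subject to the relations \begin{align*} &ba=q\,ab,\qquad a^*b=q\,ba^*,\qquad bb^*=b^*b,\qquad aa^*+bb^*=1,\qquad a^*a+|q|^2b^*b=1,\\ &aD=Da,\qquad bD=q^2|q|^{-2}Db,\qquad DD^*=D^*D=1 \end{align*} (this is the underlying $C^*$-algebra of the compact quantum group $U_q(2)$). **Theorem.** Let $q$ be a non-real complex number with $|q|\neq 1$ such that $\theta=\frac1\pi\arg(q)$ is irrational, and let $q'$ be a nonzero real number. Then the $C^*$-algebras $C(U_q(2))$ and $C(U_{q'}(2))$ are not isomorphic, i.e. there is no $*$-isomorphism between them. -/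

import Mathlib

open scoped ENNReal

noncomputable section

/-- The defining relations of `C(U_q(2))` for a triple `a, b, D` in a unital complex `*`-algebra. -/
structure UqRelations (q : ℂ) {A : Type*} [Ring A] [StarRing A] [Algebra ℂ A] (a b D : A) :
    Prop where
  b_mul_a : b * a = q • (a * b)
  star_a_mul_b : star a * b = q • (b * star a)
  b_normal : b * star b = star b * b
  sum_one : a * star a + b * star b = 1
  a_comm_D : a * D = D * a
  b_mul_D : b * D = (q ^ 2 * ((‖q‖ : ℂ) ^ 2)⁻¹) • (D * b)
  D_mul_star : D * star D = 1
  star_mul_D : star D * D = 1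
  sum_one' : star a * a + ((‖q‖ : ℂ) ^ 2) • (star b * b) = 1

/-- A nonzero unital C⋆-algebra together with a triple of elements satisfying the relations. -/
structure UqRep (q : ℂ) where
  carrier : Type
  [cstar : CStarAlgebra carrier]
  [nontriv : Nontrivial carrier]
  a : carrier
  b : carrier
  D : carrier
  rel : UqRelations q a b D

namespace UqRep

attribute [instance] cstar nontriv

end UqRep

/-- In a C⋆-algebra, `x x⋆ + y y⋆ = 1` forces `‖x‖ ≤ 1`. -/
theorem norm_le_one_of_mul_star_add {A : Type*} [CStarAlgebra A] [Nontrivial A] {x y : A}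
    (h : x * star x + y * star y = 1) : ‖x‖ ≤ 1 := by
  let _ := CStarAlgebra.spectralOrder A
  have _ := CStarAlgebra.spectralOrderedRing A
  have h1 : x * star x ≤ 1 := by
    rw [← h]; exact le_add_of_nonneg_right (mul_star_self_nonneg y)
  have h2 : ‖x * star x‖ ≤ ‖(1 : A)‖ :=
    CStarAlgebra.norm_le_norm_of_nonneg_of_le (mul_star_self_nonneg x) h1
  rw [CStarRing.norm_self_mul_star, CStarRing.norm_one] at h2
  nlinarith [norm_nonneg x]

namespace UqRelations

variable {q : ℂ} {A : Type*} [CStarAlgebra A] [Nontrivial A] {a b D : A}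

theorem norm_a_le (h : UqRelations q a b D) : ‖a‖ ≤ 1 :=
  norm_le_one_of_mul_star_add h.sum_one

theorem norm_b_le (h : UqRelations q a b D) : ‖b‖ ≤ 1 :=
  norm_le_one_of_mul_star_add ((add_comm _ _).trans h.sum_one)

theorem norm_D_le (h : UqRelations q a b D) : ‖D‖ ≤ 1 :=
  norm_le_one_of_mul_star_add (y := 0) (by simpa using h.D_mul_star)

end UqRelations

namespace CUq

/-- The `ℓ^∞`-product of all the C⋆-algebras carrying a triple that satisfies the relations. -/
abbrev Prod (q : ℂ) : Type 1 := lp (fun π : UqRep q => π.carrier) ∞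

instance (q : ℂ) : CStarAlgebra (Prod q) where

def prodA (q : ℂ) : Prod q :=
  ⟨fun π => π.a, memℓp_infty ⟨1, by rintro _ ⟨π, rfl⟩; exact π.rel.norm_a_le⟩⟩

def prodB (q : ℂ) : Prod q :=
  ⟨fun π => π.b, memℓp_infty ⟨1, by rintro _ ⟨π, rfl⟩; exact π.rel.norm_b_le⟩⟩

def prodD (q : ℂ) : Prod q :=
  ⟨fun π => π.D, memℓp_infty ⟨1, by rintro _ ⟨π, rfl⟩; exact π.rel.norm_D_le⟩⟩

/-- The unital C⋆-subalgebra of the product generated by the three tautological families. -/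
def subalg (q : ℂ) : StarSubalgebra ℂ (Prod q) :=
  (StarAlgebra.adjoin ℂ {prodA q, prodB q, prodD q}).topologicalClosure

end CUq

/-- `C(U_q(2))`: the universal unital C⋆-algebra generated by `a, b, D` subject to the relations
`UqRelations q a b D`. It is realized as the C⋆-algebra generated by `(π(a))_π, (π(b))_π, (π(D))_π`
in the product over all representations `π` of the relations. That it has the universal property
with respect to C⋆-algebras in every universe is `CUq.existsUnique_hom` below. -/
def CUq (q : ℂ) : Type 1 := CUq.subalg q

namespace CUq

instance (q : ℂ) : CStarAlgebra (CUq q) :=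
  StarSubalgebra.cstarAlgebra (subalg q)
    (h_closed := StarSubalgebra.isClosed_topologicalClosure _)

theorem subset_subalg (q : ℂ) : {prodA q, prodB q, prodD q} ⊆ (subalg q : Set (Prod q)) :=
  (StarAlgebra.subset_adjoin ℂ _).trans (StarSubalgebra.le_topologicalClosure _)

/-- The canonical generator `a` of `C(U_q(2))`. -/
def a (q : ℂ) : CUq q := ⟨prodA q, subset_subalg q (by simp)⟩

/-- The canonical generator `b` of `C(U_q(2))`. -/
def b (q : ℂ) : CUq q := ⟨prodB q, subset_subalg q (by simp)⟩

/-- The canonical generator `D` of `C(U_q(2))`. -/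
def D (q : ℂ) : CUq q := ⟨prodD q, subset_subalg q (by simp)⟩

theorem relations (q : ℂ) : UqRelations q (a q) (b q) (D q) := by
  constructor <;> apply Subtype.ext <;> apply lp.ext <;> funext π
  · exact π.rel.b_mul_a
  · exact π.rel.star_a_mul_b
  · exact π.rel.b_normal
  · exact π.rel.sum_one
  · exact π.rel.a_comm_D
  · exact π.rel.b_mul_D
  · exact π.rel.D_mul_star
  · exact π.rel.star_mul_D
  · exact π.rel.sum_one'

/-- Evaluation of `C(U_q(2))` at a triple satisfying the relations. -/
def eval {q : ℂ} (π : UqRep q) : CUq q →⋆ₐ[ℂ] π.carrier where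
  toFun x := x.1 π
  map_one' := rfl
  map_mul' _ _ := rfl
  map_zero' := rfl
  map_add' _ _ := rfl
  commutes' _ := rfl
  map_star' _ := rfl

/-- Two homomorphisms that agree on the generators are equal. -/
theorem hom_ext {q : ℂ} {A : Type*} [CStarAlgebra A] {φ ψ : CUq q →⋆ₐ[ℂ] A}
    (ha : φ (a q) = ψ (a q)) (hb : φ (b q) = ψ (b q)) (hD : φ (D q) = ψ (D q)) : φ = ψ := by
  have hφ : Continuous φ :=
    AddMonoidHomClass.continuous_of_bound φ 1 fun x => by
      simpa only [one_mul] using NonUnitalStarAlgHom.norm_apply_le φ x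
  have hψ : Continuous ψ :=
    AddMonoidHomClass.continuous_of_bound ψ 1 fun x => by
      simpa only [one_mul] using NonUnitalStarAlgHom.norm_apply_le ψ x
  refine StarAlgHom.ext_topologicalClosure (S := StarAlgebra.adjoin ℂ {prodA q, prodB q, prodD q})
    (φ := φ) (ψ := ψ) hφ hψ ?_
  let ι : StarAlgebra.adjoin ℂ {prodA q, prodB q, prodD q} →⋆ₐ[ℂ] CUq q :=
    StarSubalgebra.inclusion (StarSubalgebra.le_topologicalClosure _)
  change φ.comp ι = ψ.comp ι
  ext x
  induction x using StarAlgebra.adjoin_induction_subtype with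
  | mem x hx =>
    rcases hx with rfl | rfl | rfl
    · exact ha
    · exact hb
    · exact hD
  | algebraMap r => rw [AlgHomClass.commutes, AlgHomClass.commutes]
  | add x y hx hy => rw [map_add, map_add, hx, hy]
  | mul x y hx hy => rw [map_mul, map_mul, hx, hy]
  | star x hx => rw [map_star, map_star, hx]

/-- The C⋆-algebra generated by three elements is small: it has at most continuum many elements. -/
theorem small_closure {A : Type*} [CStarAlgebra A] (x : Fin 3 → A) :
    Small.{0} (StarAlgebra.adjoin ℂ (Set.range x)).topologicalClosure := by
  let f : FreeAlgebra ℂ (Fin 3 ⊕ Fin 3) →ₐ[ℂ] A :=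
    FreeAlgebra.lift ℂ (Sum.elim x (fun i => star (x i)))
  have hf : ((StarAlgebra.adjoin ℂ (Set.range x) : StarSubalgebra ℂ A) : Set A) ⊆ Set.range f := by
    have h : Algebra.adjoin ℂ (Set.range x ∪ star (Set.range x)) ≤ f.range := by
      rw [Algebra.adjoin_le_iff]
      rintro y (⟨i, rfl⟩ | ⟨i, hi⟩)
      · exact ⟨FreeAlgebra.ι ℂ (Sum.inl i), by simp [f]⟩
      · exact ⟨FreeAlgebra.ι ℂ (Sum.inr i), by simp [f, hi]⟩
    exact h
  let g : (ℕ → FreeAlgebra ℂ (Fin 3 ⊕ Fin 3)) → A :=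
    fun u => Filter.limUnder Filter.atTop (fun n => f (u n))
  refine small_subset (s := Set.range g) (t := (_ : Set A)) fun y hy => ?_
  obtain ⟨v, hv, hlim⟩ := mem_closure_iff_seq_limit.1 hy
  choose u hu using fun n => hf (hv n)
  exact ⟨u, Filter.Tendsto.limUnder_eq (by simpa [hu] using hlim)⟩

/-- A small C⋆-algebra is isomorphic to one in the lowest universe. -/
theorem exists_type_model (B : Type*) [CStarAlgebra B] [Small.{0} B] :
    ∃ (C : Type) (_ : CStarAlgebra C), Nonempty (C ≃⋆ₐ[ℂ] B) := by
  let e : Shrink.{0} B ≃ B := (equivShrink B).symm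
  let _ : Ring (Shrink.{0} B) := e.ring
  let _ : Algebra ℂ (Shrink.{0} B) := e.algebra ℂ
  let _ : StarRing (Shrink.{0} B) := e.starRing
  let _ : NormedRing (Shrink.{0} B) := NormedRing.induced _ B e.ringEquiv e.injective
  have hn (x : Shrink.{0} B) : ‖x‖ = ‖e x‖ := rfl
  have hi : Isometry e := fun _ _ => rfl
  let _ : NormedAlgebra ℂ (Shrink.{0} B) :=
    { norm_smul_le := fun r x => by
        rw [hn, hn, show e (r • x) = r • e x from e.apply_symm_apply _]; exact norm_smul_le _ _ }
  have : CompleteSpace (Shrink.{0} B) :=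
    (IsometryEquiv.mk e hi).completeSpace
  have hm (x y : Shrink.{0} B) : e (x * y) = e x * e y := e.apply_symm_apply _
  have hs (x : Shrink.{0} B) : e (star x) = star (e x) := e.apply_symm_apply _
  have : CStarRing (Shrink.{0} B) :=
    ⟨fun x => by rw [hn, hn, hm, hs]; exact CStarRing.norm_mul_self_le _⟩
  have : StarModule ℂ (Shrink.{0} B) :=
    ⟨fun r x => e.injective <| by
      rw [hs, show e (r • x) = r • e x from e.apply_symm_apply _,
        show e (star r • star x) = star r • e (star x) from e.apply_symm_apply _, hs, star_smul]⟩
  exact ⟨Shrink.{0} B, { }, ⟨{ e with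
    map_mul' := hm
    map_add' := fun _ _ => e.apply_symm_apply _
    map_star' := hs
    map_smul' := fun _ _ => e.apply_symm_apply _ }⟩⟩

/-- The universal property of `C(U_q(2))`. -/
theorem existsUnique_hom {q : ℂ} {A : Type*} [CStarAlgebra A] {x y z : A}
    (h : UqRelations q x y z) :
    ∃! φ : CUq q →⋆ₐ[ℂ] A, φ (a q) = x ∧ φ (b q) = y ∧ φ (D q) = z := by
  refine existsUnique_of_exists_of_unique ?_ fun φ ψ hφ hψ => hom_ext
    (hφ.1.trans hψ.1.symm) (hφ.2.1.trans hψ.2.1.symm) (hφ.2.2.trans hψ.2.2.symm)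
  rcases subsingleton_or_nontrivial A with hA | hA
  · exact ⟨{
      toFun := fun _ => 0
      map_one' := Subsingleton.elim _ _
      map_mul' := fun _ _ => Subsingleton.elim _ _
      map_zero' := Subsingleton.elim _ _
      map_add' := fun _ _ => Subsingleton.elim _ _
      commutes' := fun _ => Subsingleton.elim _ _
      map_star' := fun _ => Subsingleton.elim _ _ }, Subsingleton.elim _ _, Subsingleton.elim _ _, Subsingleton.elim _ _⟩
  let v : Fin 3 → A := ![x, y, z]
  let S := (StarAlgebra.adjoin ℂ (Set.range v)).topologicalClosure
  let _ : CStarAlgebra S := StarSubalgebra.cstarAlgebra S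
    (h_closed := StarSubalgebra.isClosed_topologicalClosure _)
  have : Small.{0} S := small_closure v
  obtain ⟨C, _, ⟨e⟩⟩ := exists_type_model S
  have hv (i : Fin 3) : v i ∈ S :=
    StarSubalgebra.le_topologicalClosure _ (StarAlgebra.subset_adjoin ℂ _ ⟨i, rfl⟩)
  have : Nontrivial C := e.toEquiv.nontrivial
  let j : C →⋆ₐ[ℂ] A := S.subtype.comp (e : C →⋆ₐ[ℂ] S)
  have hj : Function.Injective j := Subtype.val_injective.comp e.injective
  have hjv (i : Fin 3) : j (e.symm ⟨v i, hv i⟩) = v i :=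
    congrArg Subtype.val (e.apply_symm_apply ⟨v i, hv i⟩)
  have h0 : j (e.symm ⟨v 0, hv 0⟩) = x := hjv 0
  have h1 : j (e.symm ⟨v 1, hv 1⟩) = y := hjv 1
  have h2 : j (e.symm ⟨v 2, hv 2⟩) = z := hjv 2
  let π : UqRep q :=
    { carrier := C, a := e.symm ⟨v 0, hv 0⟩, b := e.symm ⟨v 1, hv 1⟩, D := e.symm ⟨v 2, hv 2⟩
      rel := by
        constructor <;> apply hj <;>
          simp only [map_mul, map_star, map_add, map_one, map_smul, h0, h1, h2]
        · exact h.b_mul_a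
        · exact h.star_a_mul_b
        · exact h.b_normal
        · exact h.sum_one
        · exact h.a_comm_D
        · exact h.b_mul_D
        · exact h.D_mul_star
        · exact h.star_mul_D
        · exact h.sum_one' }
  exact ⟨j.comp (eval π), h0, h1, h2⟩

end CUq

end

/-!
The two algebras are told apart by their centers. For real `q'` the phase `(q' / |q'|)²` is `1`, so
the unitary `D` is central, and it is not a scalar because it takes different values on characters
(`CUq.D_mem_center`, `CUq.D_ne_algebraMap`). For `q` of irrational angle and `|q| ≠ 1` the center of
`C(U_q(2))` consists of scalars (`CUq.exists_eq_algebraMap_of_mem_center`).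

To compute that center, take `|q| < 1`; the substitution `(a, b, D) ↦ (a⋆, q b, D⋆)` interchanges
`q` and `q⁻¹`. By universality the torus acts on the algebra by `a ↦ s a`, `D ↦ t D`. As the orbit
map of an element is continuous, an element is determined by its Fourier coefficients under this
action, the spectral components (`GaugedTriple.eq_zero_of_spectralProj_eq_zero`), and the components
of a central element are again central.

* A central `x` of weight zero is a scalar (`GaugedTriple.exists_eq_algebraMap_of_gauge_eq`). Every
  word `W` in the generators satisfies `W aⁿ ≈ c aⁿ⁺ⁱ Dᵏ` for large `n`, where `(i, k)` is its
  weight: indeed `b aⁿ = qⁿ aⁿ b` tends to zero, and `a⋆ aⁿ⁺¹ - aⁿ` is a multiple of `b⋆b aⁿ`. So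
  `aⁿ (x - c) = (x - c) aⁿ` is small for a suitable scalar `c`, and `x - c` is then small itself,
  because `‖aⁿ y‖ ≥ ∏ (1 - |q|²ʲ) ‖y‖` with a convergent product
  (`UqRelations.prod_mul_norm_le`).
* A central `y` of weight `(i, k) ≠ 0` vanishes
  (`GaugedTriple.spectralProj_eq_zero_of_mem_center`). It satisfies `b y = qⁱ (q / |q|)²ᵏ y b` as
  well as `b y = y b`, and the factor is not `1`, so `y b = 0`. But `y⋆y` is central of weight zero,
  hence a scalar, and `b ≠ 0`; so `y⋆y = 0`.

That `b ≠ 0` is seen in a representation by weighted shifts on `ℓ²(ℕ × ℤ)`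
(`exists_uqRelations_b_ne_zero`).
-/

open Filter Topology MeasureTheory

noncomputable section

universe u

/-! ### q-commutation and the growth of `aⁿ` -/

namespace UqRelations

section Ring

variable {q : ℂ} {A : Type*} [Ring A] [StarRing A] [Algebra ℂ A] {a b D : A}

theorem star_b_mul_a [StarModule ℂ A] (h : UqRelations q a b D) :
    star b * a = star q • (a * star b) := by
  simpa using congrArg star h.star_a_mul_b

theorem b_mul_star_a (h : UqRelations q a b D) (hq : q ≠ 0) :
    b * star a = q⁻¹ • (star a * b) := by
  rw [h.star_a_mul_b, inv_smul_smul₀ hq]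

theorem star_b_mul_b_mul_a [StarModule ℂ A] (h : UqRelations q a b D) :
    star b * b * a = ((‖q‖ : ℂ) ^ 2) • (a * (star b * b)) := by
  rw [mul_assoc, h.b_mul_a, mul_smul_comm, ← mul_assoc, h.star_b_mul_a, smul_mul_assoc, smul_smul,
    ← Complex.mul_conj', mul_assoc]
  rfl

theorem b_mul_a_pow (h : UqRelations q a b D) (n : ℕ) : b * a ^ n = q ^ n • (a ^ n * b) := by
  induction n with
  | zero => simp
  | succ n ih =>
    rw [pow_succ, ← mul_assoc, ih, smul_mul_assoc, mul_assoc, h.b_mul_a, mul_smul_comm, smul_smul,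
      ← pow_succ, mul_assoc]

theorem star_b_mul_a_pow [StarModule ℂ A] (h : UqRelations q a b D) (n : ℕ) :
    star b * a ^ n = star q ^ n • (a ^ n * star b) := by
  induction n with
  | zero => simp
  | succ n ih =>
    rw [pow_succ, ← mul_assoc, ih, smul_mul_assoc, mul_assoc, h.star_b_mul_a, mul_smul_comm,
      smul_smul, ← pow_succ, mul_assoc]

theorem star_b_mul_b_mul_a_pow [StarModule ℂ A] (h : UqRelations q a b D) (n : ℕ) :
    star b * b * a ^ n = ((‖q‖ : ℂ) ^ 2) ^ n • (a ^ n * (star b * b)) := by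
  induction n with
  | zero => simp
  | succ n ih =>
    rw [pow_succ, ← mul_assoc, ih, smul_mul_assoc, mul_assoc, h.star_b_mul_b_mul_a, mul_smul_comm,
      smul_smul, ← pow_succ, mul_assoc]

theorem star_a_mul_a_pow_succ [StarModule ℂ A] (h : UqRelations q a b D) (n : ℕ) :
    star a * a ^ (n + 1) = a ^ n - ((‖q‖ : ℂ) ^ 2) ^ (n + 1) • (a ^ n * (star b * b)) := by
  rw [pow_succ', ← mul_assoc, eq_sub_of_add_eq h.sum_one', sub_mul, one_mul, smul_mul_assoc,
    h.star_b_mul_b_mul_a_pow, smul_smul, ← pow_succ']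

theorem star_D_mul_a (h : UqRelations q a b D) : star D * a = a * star D := by
  calc star D * a = star D * (a * (D * star D)) := by rw [h.D_mul_star, mul_one]
    _ = star D * (a * D) * star D := by simp only [mul_assoc]
    _ = a * star D := by rw [h.a_comm_D, ← mul_assoc, h.star_mul_D, one_mul]

theorem b_mul_star_D (h : UqRelations q a b D) (hq : q ≠ 0) :
    b * star D = (q ^ 2 * ((‖q‖ : ℂ) ^ 2)⁻¹)⁻¹ • (star D * b) := by
  have h0 : q ^ 2 * ((‖q‖ : ℂ) ^ 2)⁻¹ ≠ 0 := by simp [hq]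
  calc b * star D = star D * D * (b * star D) := by rw [h.star_mul_D, one_mul]
    _ = star D * (D * b) * star D := by simp only [mul_assoc]
    _ = _ := by
      rw [← inv_smul_smul₀ h0 (D * b), ← h.b_mul_D, mul_smul_comm, smul_mul_assoc,
        mul_assoc, mul_assoc, h.D_mul_star, mul_one]

end Ring

/-- The relations for `q` and for `q⁻¹` are interchanged by `(a, b, D) ↦ (a⋆, q b, D⋆)`. -/
theorem inv {q : ℂ} (hq : q ≠ 0) {A : Type*} [Ring A] [StarRing A] [Algebra ℂ A] [StarModule ℂ A]
    {a b D : A} (h : UqRelations q a b D) : UqRelations q⁻¹ (star a) (q • b) (star D) := by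
  have hn : ((‖q‖ : ℂ) ^ 2) ≠ 0 := by simp [hq]
  have hc : q * star q = (‖q‖ : ℂ) ^ 2 := Complex.mul_conj' q
  have hc' : star q * q = (‖q‖ : ℂ) ^ 2 := (mul_comm _ _).trans hc
  refine ⟨?_, ?_, ?_, ?_, ?_, ?_, ?_, ?_, ?_⟩
  · rw [smul_mul_assoc, ← h.star_a_mul_b, mul_smul_comm, inv_smul_smul₀ hq]
  · rw [star_star, mul_smul_comm, ← h.b_mul_a, smul_mul_assoc, inv_smul_smul₀ hq]
  · simp only [star_smul, smul_mul_smul_comm, h.b_normal, mul_comm]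
  · rw [star_smul, star_star, smul_mul_smul_comm, hc, h.b_normal, h.sum_one']
  · rw [← star_mul, ← star_mul, h.a_comm_D]
  · rw [smul_mul_assoc, h.b_mul_star_D hq, mul_smul_comm, smul_comm]
    congr 1
    simp [mul_comm]
  · rw [star_star, h.star_mul_D]
  · rw [star_star, h.D_mul_star]
  · rw [star_smul, star_star, smul_mul_smul_comm, hc', norm_inv, smul_smul, ← h.b_normal]
    push_cast
    rw [inv_pow, inv_mul_cancel₀ hn, one_smul, h.sum_one]

section CStar

variable {q : ℂ} {A : Type*} [CStarAlgebra A] [Nontrivial A] {a b D : A}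

theorem norm_star_b_mul_b_le (h : UqRelations q a b D) : ‖star b * b‖ ≤ 1 := by
  rw [CStarRing.norm_star_mul_self]
  exact mul_le_one₀ h.norm_b_le (norm_nonneg _) h.norm_b_le

theorem norm_a_pow_le (h : UqRelations q a b D) (n : ℕ) : ‖a ^ n‖ ≤ 1 :=
  (norm_pow_le a n).trans (pow_le_one₀ (norm_nonneg _) h.norm_a_le)

/-- Since `a⋆ aⁿ⁺¹ = aⁿ (1 - |q|²ⁿ⁺² b⋆b)` and `‖a⋆‖, ‖b⋆b‖ ≤ 1`, left multiplication by `aⁿ` is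
bounded below by a partial product of the `|q|²`-Pochhammer symbol. -/
theorem prod_mul_norm_le (h : UqRelations q a b D) (hq1 : ‖q‖ < 1) (n : ℕ) (y : A) :
    (∏ j ∈ Finset.range n, (1 - (‖q‖ ^ 2) ^ (j + 1))) * ‖y‖ ≤ ‖a ^ n * y‖ := by
  induction n generalizing y with
  | zero => simp
  | succ n ih =>
    set r := ‖q‖ ^ 2 with hr
    have hr1 : r ≤ 1 := pow_le_one₀ (norm_nonneg _) hq1.le
    have hr0 : 0 ≤ r := by positivity
    have h1 : star a * (a ^ (n + 1) * y)
        = a ^ n * (y - ((‖q‖ : ℂ) ^ 2) ^ (n + 1) • (star b * b * y)) := by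
      rw [← mul_assoc, h.star_a_mul_a_pow_succ, sub_mul, mul_sub, smul_mul_assoc, mul_smul_comm,
        mul_assoc (a ^ n)]
    have h2 : ‖a ^ n * (y - ((‖q‖ : ℂ) ^ 2) ^ (n + 1) • (star b * b * y))‖
        ≤ ‖a ^ (n + 1) * y‖ := by
      rw [← h1]
      refine (norm_mul_le _ _).trans (mul_le_of_le_one_left (norm_nonneg _) ?_)
      rw [norm_star]; exact h.norm_a_le
    refine le_trans ?_ ((ih _).trans h2)
    rw [Finset.prod_range_succ, mul_assoc]
    refine mul_le_mul_of_nonneg_left ?_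
      (Finset.prod_nonneg fun j _ => sub_nonneg.2 (pow_le_one₀ hr0 hr1))
    have h3 : ‖((‖q‖ : ℂ) ^ 2) ^ (n + 1) • (star b * b * y)‖ ≤ r ^ (n + 1) * ‖y‖ := by
      rw [norm_smul]
      have : ‖((‖q‖ : ℂ) ^ 2) ^ (n + 1)‖ = r ^ (n + 1) := by simp [hr]
      rw [this]
      refine mul_le_mul_of_nonneg_left ?_ (by positivity)
      exact (norm_mul_le _ _).trans
        (mul_le_of_le_one_left (norm_nonneg _) h.norm_star_b_mul_b_le)
    have h4 := norm_sub_norm_le y (((‖q‖ : ℂ) ^ 2) ^ (n + 1) • (star b * b * y))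
    linarith

end CStar

end UqRelations

/-- The Pochhammer symbol `(r; r)_∞` is positive for `0 ≤ r < 1`. -/
theorem exists_pos_le_prod_one_sub_pow {r : ℝ} (h0 : 0 ≤ r) (h1 : r < 1) :
    ∃ δ > 0, ∀ n : ℕ, δ ≤ ∏ j ∈ Finset.range n, (1 - r ^ (j + 1)) := by
  have hs : 0 < 1 - r := sub_pos.2 h1
  refine ⟨Real.exp (-(1 / (1 - r) ^ 2)), Real.exp_pos _, fun n => ?_⟩
  have key (j : ℕ) : Real.exp (-(r ^ j / (1 - r))) ≤ 1 - r ^ (j + 1) := by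
    have hx : r ^ (j + 1) ≤ r := pow_le_of_le_one h0 h1.le (Nat.succ_ne_zero j)
    have hx0 : 0 ≤ r ^ j := by positivity
    have hp : 0 < 1 - r ^ (j + 1) := by linarith
    rw [Real.exp_neg]
    refine inv_le_of_inv_le₀ hp ?_
    refine le_trans ?_ (Real.add_one_le_exp _)
    rw [inv_eq_one_div, div_le_iff₀ hp, div_add_one hs.ne', div_mul_eq_mul_div, le_div_iff₀ hs]
    have hx2 : r ^ (j + 1) = r * r ^ j := pow_succ' r j
    have hx3 : r ^ j ≤ 1 := pow_le_one₀ h0 h1.le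
    rw [hx2] at hx ⊢
    nlinarith [mul_nonneg hx0 hs.le, mul_nonneg h0 hx0, mul_nonneg hx0 (sub_nonneg.2 hx)]
  calc Real.exp (-(1 / (1 - r) ^ 2))
      ≤ Real.exp (∑ j ∈ Finset.range n, -(r ^ j / (1 - r))) := by
        rw [Real.exp_le_exp, Finset.sum_neg_distrib, neg_le_neg_iff, ← Finset.sum_div,
          div_le_div_iff₀ hs (by positivity)]
        have := geom_sum_mul_neg r n
        have h3 : 0 ≤ r ^ n := by positivity
        nlinarith
    _ = ∏ j ∈ Finset.range n, Real.exp (-(r ^ j / (1 - r))) := Real.exp_sum _ _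
    _ ≤ _ := Finset.prod_le_prod (fun _ _ => (Real.exp_pos _).le) fun j _ => key j

/-! ### Haar measure and characters of the torus -/

/-- The Borel σ-algebra; Mathlib puts no measurable structure on `Circle`. -/
instance : MeasurableSpace (Circle × Circle) := borel _

instance : BorelSpace (Circle × Circle) := ⟨rfl⟩

/-- The normalized Haar measure of the two-dimensional torus. -/
def torusHaar : Measure (Circle × Circle) := Measure.haarMeasure ⊤

instance : torusHaar.IsHaarMeasure := inferInstanceAs (Measure.haarMeasure ⊤).IsHaarMeasure

instance : IsProbabilityMeasure torusHaar := by
  have h := Measure.haarMeasure_self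
    (K₀ := (⊤ : TopologicalSpace.PositiveCompacts (Circle × Circle)))
  exact ⟨by simpa [torusHaar] using h⟩

/-- The character `(s, t) ↦ sⁱ tᵏ` of the torus with weight `m = (i, k)`. -/
def torusChar (m : ℤ × ℤ) (g : Circle × Circle) : ℂ := (g.1 ^ m.1 * g.2 ^ m.2 : Circle)

theorem continuous_torusChar (m : ℤ × ℤ) : Continuous (torusChar m) :=
  have h : Continuous fun g : Circle × Circle => g.1 ^ m.1 * g.2 ^ m.2 := by fun_prop
  continuous_subtype_val.comp h

theorem norm_torusChar (m : ℤ × ℤ) (g : Circle × Circle) : ‖torusChar m g‖ = 1 :=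
  Circle.norm_coe _

theorem torusChar_add (m n : ℤ × ℤ) (g : Circle × Circle) :
    torusChar (m + n) g = torusChar m g * torusChar n g := by
  simp only [torusChar, ← Circle.coe_mul, Prod.fst_add, Prod.snd_add, zpow_add]
  congr 1
  exact mul_mul_mul_comm _ _ _ _

theorem torusChar_zero (g : Circle × Circle) : torusChar 0 g = 1 := by simp [torusChar]

theorem torusChar_neg (m : ℤ × ℤ) (g : Circle × Circle) :
    torusChar (-m) g = star (torusChar m g) := by
  rw [torusChar, torusChar, Complex.star_def, ← Circle.coe_inv_eq_conj, mul_inv]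
  simp

theorem torusChar_mul (m : ℤ × ℤ) (g h : Circle × Circle) :
    torusChar m (g * h) = torusChar m g * torusChar m h := by
  simp only [torusChar, ← Circle.coe_mul, Prod.fst_mul, Prod.snd_mul, mul_zpow]
  congr 1
  exact mul_mul_mul_comm _ _ _ _

theorem torusChar_neg_mul_self (m : ℤ × ℤ) (g : Circle × Circle) :
    torusChar (-m) g * torusChar m g = 1 := by
  rw [← torusChar_add, neg_add_cancel, torusChar_zero]

theorem exists_torusChar_ne_one {m : ℤ × ℤ} (hm : m ≠ 0) : ∃ g, torusChar m g ≠ 1 := by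
  have key (i : ℤ) (hi : i ≠ 0) : ∃ s : Circle, s ^ i ≠ 1 := by
    refine ⟨Circle.exp (Real.pi / i), ?_⟩
    rw [← Circle.exp_intCast_mul, mul_div_cancel₀ _ (by exact_mod_cast hi : (i : ℝ) ≠ 0)]
    exact Circle.exp_pi_ne_one
  by_cases h1 : m.1 = 0
  · have h2 : m.2 ≠ 0 := fun h2 => hm (Prod.ext h1 h2)
    obtain ⟨s, hs⟩ := key _ h2
    refine ⟨(1, s), ?_⟩
    rw [torusChar, Ne, Circle.coe_eq_one]
    simpa using hs
  · obtain ⟨s, hs⟩ := key _ h1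
    refine ⟨(s, 1), ?_⟩
    rw [torusChar, Ne, Circle.coe_eq_one]
    simpa using hs

theorem integral_torusChar {m : ℤ × ℤ} (hm : m ≠ 0) : ∫ g, torusChar m g ∂torusHaar = 0 := by
  obtain ⟨h, hh⟩ := exists_torusChar_ne_one hm
  have h1 : ∫ g, torusChar m (h * g) ∂torusHaar = ∫ g, torusChar m g ∂torusHaar :=
    integral_mul_left_eq_self _ h
  simp only [torusChar_mul] at h1
  rw [integral_const_mul] at h1
  by_contra h0
  exact hh (mul_right_cancel₀ h0 (h1.trans (one_mul _).symm))

/-! ### Words in the generators -/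

/-- A triple satisfying the relations and generating `A`, together with the *gauge action* `α` of
the torus on `A`: the pair `(s, t)` acts by `a ↦ s a`, `b ↦ b`, `D ↦ t D`. -/
structure GaugedTriple (q : ℂ) {A : Type*} [CStarAlgebra A] (a b D : A)
    (α : Circle × Circle → A →⋆ₐ[ℂ] A) : Prop extends UqRelations q a b D where
  dense : Dense (StarAlgebra.adjoin ℂ {a, b, D} : Set A)
  map_a : ∀ g, α g a = (g.1 : ℂ) • a
  map_b : ∀ g, α g b = b
  map_D : ∀ g, α g D = (g.2 : ℂ) • D

/-- The monoid of words in `a, a⋆, b, b⋆, D, D⋆`. -/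
def wordMonoid {A : Type*} [CStarAlgebra A] (a b D : A) : Submonoid A :=
  Submonoid.closure ({a, b, D} ∪ star {a, b, D})

/-- The scalar by which `b` `q`-commutes with words containing `a` with multiplicity `m.1` and `D`
with multiplicity `m.2`. -/
def commFactor (q : ℂ) (m : ℤ × ℤ) : ℂ := q ^ m.1 * (q ^ 2 * ((‖q‖ : ℂ) ^ 2)⁻¹) ^ m.2

theorem commFactor_add {q : ℂ} (hq : q ≠ 0) (m n : ℤ × ℤ) :
    commFactor q (m + n) = commFactor q m * commFactor q n := by
  have hω : q ^ 2 * ((‖q‖ : ℂ) ^ 2)⁻¹ ≠ 0 := by simp [hq]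
  rw [commFactor, Prod.fst_add, Prod.snd_add, zpow_add₀ hq, zpow_add₀ hω]
  exact mul_mul_mul_comm _ _ _ _

theorem commFactor_zero (q : ℂ) : commFactor q 0 = 1 := by simp [commFactor]

/-- For `|q| ≠ 1`, the modulus of `commFactor q (i, k)` is `|q|ⁱ` and so determines `i`; the phase
then determines `k` unless `(q / |q|)²` is a root of unity. -/
theorem commFactor_ne_one {q : ℂ} (hq : q ≠ 0) (hq1 : ‖q‖ ≠ 1)
    (hω : ∀ k : ℤ, (q ^ 2 * ((‖q‖ : ℂ) ^ 2)⁻¹) ^ k = 1 → k = 0) {m : ℤ × ℤ} (hm : m ≠ 0) :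
    commFactor q m ≠ 1 := by
  intro h
  have h1 : m.1 = 0 := by
    have h2 := congrArg norm h
    have h3 : ‖q‖ ^ 2 ≠ 0 := by simp [hq]
    rw [commFactor, norm_mul, norm_zpow, norm_zpow, norm_mul, norm_inv, norm_pow, norm_pow,
      Complex.norm_real, norm_norm, mul_inv_cancel₀ h3, one_zpow, mul_one, norm_one] at h2
    exact (zpow_eq_one_iff_right₀ (norm_nonneg q) hq1).1 h2
  rw [commFactor, h1, zpow_zero, one_mul] at h
  exact hm (Prod.ext h1 (hω _ h))

/-- `W` has weight `m`: it is an eigenvector of the gauge action and `q`-commutes with `b`. -/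
structure HasWeight (q : ℂ) {A : Type*} [CStarAlgebra A] (b : A)
    (α : Circle × Circle → A →⋆ₐ[ℂ] A) (m : ℤ × ℤ) (W : A) : Prop where
  gauge : ∀ g, α g W = torusChar m g • W
  b_mul : b * W = commFactor q m • (W * b)

/-- `W` acts on `aⁿ`, asymptotically in `n`, as a multiple of the monomial in `a` and `D` of
weight `m`. Integer exponents are encoded as differences of natural numbers. -/
def HasLeadingTerm {A : Type*} [CStarAlgebra A] (a D : A) (m : ℤ × ℤ) (W : A) : Prop :=
  ∃ (i i' k k' : ℕ) (c : ℂ), m + ((i' : ℤ), (k' : ℤ)) = ((i : ℤ), (k : ℤ)) ∧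
    Tendsto (fun n : ℕ => W * a ^ (n + i') * D ^ k' - c • (a ^ (n + i) * D ^ k)) atTop (𝓝 0)

theorem HasWeight.mul {q : ℂ} (hq : q ≠ 0) {A : Type*} [CStarAlgebra A] {b : A}
    {α : Circle × Circle → A →⋆ₐ[ℂ] A} {m n : ℤ × ℤ} {x y : A} (hx : HasWeight q b α m x)
    (hy : HasWeight q b α n y) : HasWeight q b α (m + n) (x * y) where
  gauge g := by rw [map_mul, hx.gauge, hy.gauge, torusChar_add, smul_mul_smul_comm]
  b_mul := by
    rw [← mul_assoc, hx.b_mul, smul_mul_assoc, mul_assoc, hy.b_mul, mul_smul_comm, smul_smul,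
      commFactor_add hq, mul_assoc]

namespace GaugedTriple

variable {q : ℂ} {A : Type*} [CStarAlgebra A] {a b D : A}
  {α : Circle × Circle → A →⋆ₐ[ℂ] A}

theorem commute_a_D (h : GaugedTriple q a b D α) : Commute a D := h.a_comm_D

theorem hasWeight_a (h : GaugedTriple q a b D α) : HasWeight q b α (1, 0) a where
  gauge g := by simp [torusChar, h.map_a]
  b_mul := by simp [commFactor, h.b_mul_a]

theorem hasWeight_star_a (h : GaugedTriple q a b D α) (hq : q ≠ 0) :
    HasWeight q b α (-1, 0) (star a) where
  gauge g := by rw [map_star, h.map_a, star_smul]; simp [torusChar, ← Circle.coe_inv_eq_conj]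
  b_mul := by simp [commFactor, h.b_mul_star_a hq]

theorem hasWeight_b (h : GaugedTriple q a b D α) : HasWeight q b α 0 b where
  gauge g := by simp [torusChar, h.map_b]
  b_mul := by simp [commFactor]

theorem hasWeight_star_b (h : GaugedTriple q a b D α) : HasWeight q b α 0 (star b) where
  gauge g := by rw [map_star, h.map_b]; simp [torusChar]
  b_mul := by simp [commFactor, h.b_normal]

theorem hasWeight_D (h : GaugedTriple q a b D α) : HasWeight q b α (0, 1) D where
  gauge g := by simp [torusChar, h.map_D]
  b_mul := by simp [commFactor, h.b_mul_D]

theorem hasWeight_star_D (h : GaugedTriple q a b D α) (hq : q ≠ 0) :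
    HasWeight q b α (0, -1) (star D) where
  gauge g := by rw [map_star, h.map_D, star_smul]; simp [torusChar, ← Circle.coe_inv_eq_conj]
  b_mul := by simp [commFactor, h.b_mul_star_D hq]

theorem tendsto_pow_smul {r : ℂ} (hr : ‖r‖ < 1) {u : ℕ → A} (C : ℝ) (hu : ∀ n, ‖u n‖ ≤ C) :
    Tendsto (fun n => r ^ n • u n) atTop (𝓝 0) :=
  (tendsto_pow_atTop_nhds_zero_of_norm_lt_one hr).zero_smul_isBoundedUnder_le
    (isBoundedUnder_of ⟨C, hu⟩)

/-- An element that `μ`-commutes with `a`, where `|μ| < 1`, is asymptotically killed by `aⁿ`. -/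
theorem tendsto_mul_a_pow [Nontrivial A] (h : GaugedTriple q a b D α) {y : A} {μ : ℂ}
    (hμ : ‖μ‖ < 1) (hy : ∀ n, y * a ^ n = μ ^ n • (a ^ n * y)) :
    Tendsto (fun n => y * a ^ n) atTop (𝓝 0) := by
  simp only [hy]
  exact tendsto_pow_smul hμ ‖y‖ fun n =>
    (norm_mul_le _ _).trans (mul_le_of_le_one_left (norm_nonneg _) (h.norm_a_pow_le n))

theorem hasLeadingTerm_mul_of_tendsto (m : ℤ × ℤ) {y W : A}
    (hy : Tendsto (fun n => y * a ^ n) atTop (𝓝 0)) (hW : HasLeadingTerm a D m W) :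
    HasLeadingTerm a D m (y * W) := by
  obtain ⟨i, i', k, k', c, hm, hl⟩ := hW
  refine ⟨i, i', k, k', 0, hm, ?_⟩
  have h1 := ((((tendsto_add_atTop_iff_nat i).2 hy).mul_const (D ^ k)).const_smul c).add
    (hl.const_mul y)
  simp only [zero_mul, smul_zero, mul_zero, add_zero] at h1
  refine h1.congr fun n => ?_
  simp only [zero_smul, sub_zero, mul_sub, mul_smul_comm, mul_assoc, add_sub_cancel]

theorem hasLeadingTerm_a_mul {m : ℤ × ℤ} {W : A} (hW : HasLeadingTerm a D m W) :
    HasLeadingTerm a D ((1, 0) + m) (a * W) := by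
  obtain ⟨i, i', k, k', c, hm, hl⟩ := hW
  refine ⟨i + 1, i', k, k', c, ?_, ?_⟩
  · rw [add_assoc, hm]; ext <;> simp [add_comm]
  · have := hl.const_mul a
    rw [mul_zero] at this
    refine this.congr fun n => ?_
    rw [mul_sub, mul_smul_comm, ← add_assoc, pow_succ' a (n + i)]
    simp only [mul_assoc]

theorem hasLeadingTerm_star_a_mul [Nontrivial A] (h : GaugedTriple q a b D α) (hq1 : ‖q‖ < 1)
    {m : ℤ × ℤ} {W : A} (hW : HasLeadingTerm a D m W) :
    HasLeadingTerm a D ((-1, 0) + m) (star a * W) := by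
  obtain ⟨i, i', k, k', c, hm, hl⟩ := hW
  refine ⟨i, i' + 1, k, k', c, ?_, ?_⟩
  · rw [← hm]; ext <;> simp; ring
  · have hnr : ‖((‖q‖ : ℂ) ^ 2)‖ < 1 := by
      simpa using pow_lt_one₀ (norm_nonneg q) hq1 two_ne_zero
    have h2 : Tendsto (fun n => star a * a ^ (n + 1) - a ^ n) atTop (𝓝 0) := by
      have h3 := (h.tendsto_mul_a_pow hnr h.star_b_mul_b_mul_a_pow).const_smul (-((‖q‖ : ℂ) ^ 2))
      rw [smul_zero] at h3
      refine h3.congr fun n => ?_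
      rw [h.star_a_mul_a_pow_succ, h.star_b_mul_b_mul_a_pow, smul_smul, neg_mul, neg_smul,
        ← pow_succ', sub_sub_cancel_left]
    have h4 := ((((tendsto_add_atTop_iff_nat i).2 h2).mul_const (D ^ k)).const_smul c).add
      (((tendsto_add_atTop_iff_nat 1).2 hl).const_mul (star a))
    simp only [zero_mul, smul_zero, mul_zero, add_zero] at h4
    refine h4.congr fun n => ?_
    rw [show n + (i' + 1) = n + 1 + i' by ring, show n + i + 1 = n + 1 + i by ring]
    simp only [mul_sub, sub_mul, smul_sub, mul_smul_comm, mul_assoc]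
    abel

theorem hasLeadingTerm_D_mul (h : GaugedTriple q a b D α) {m : ℤ × ℤ} {W : A}
    (hW : HasLeadingTerm a D m W) : HasLeadingTerm a D ((0, 1) + m) (D * W) := by
  obtain ⟨i, i', k, k', c, hm, hl⟩ := hW
  refine ⟨i, i', k + 1, k', c, ?_, ?_⟩
  · rw [add_assoc, hm]; ext <;> simp [add_comm]
  · have := hl.const_mul D
    rw [mul_zero] at this
    refine this.congr fun n => ?_
    rw [mul_sub, mul_smul_comm, pow_succ' D k, ← mul_assoc D (a ^ _),
      (h.commute_a_D.symm.pow_right (n + i)).eq]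
    simp only [mul_assoc]

theorem hasLeadingTerm_star_D_mul (h : GaugedTriple q a b D α) {m : ℤ × ℤ} {W : A}
    (hW : HasLeadingTerm a D m W) : HasLeadingTerm a D ((0, -1) + m) (star D * W) := by
  obtain ⟨i, i', k, k', c, hm, hl⟩ := hW
  refine ⟨i, i', k, k' + 1, c, ?_, ?_⟩
  · rw [← hm]; ext <;> simp; ring
  · have := (hl.const_mul (star D)).mul_const D
    rw [mul_zero, zero_mul] at this
    refine this.congr fun n => ?_
    have h1 : star D * (a ^ (n + i) * D ^ k) * D = a ^ (n + i) * D ^ k := by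
      rw [mul_assoc, mul_assoc, ← pow_succ, pow_succ' D k, ← mul_assoc (a ^ _),
        ← (h.commute_a_D.symm.pow_right (n + i)).eq,
        mul_assoc, ← mul_assoc, h.star_mul_D, one_mul]
    rw [mul_sub, sub_mul, mul_smul_comm, smul_mul_assoc, h1, pow_succ D k']
    simp only [mul_assoc]

theorem exists_hasWeight [Nontrivial A] (h : GaugedTriple q a b D α) (hq : q ≠ 0)
    (hq1 : ‖q‖ < 1) {W : A} (hW : W ∈ wordMonoid a b D) :
    ∃ m, HasWeight q b α m W ∧ HasLeadingTerm a D m W := by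
  induction hW using Submonoid.closure_induction_left with
  | one =>
    exact ⟨0, ⟨fun g => by simp [torusChar_zero], by simp [commFactor_zero]⟩, 0, 0, 0, 0, 1,
      by simp, by simp⟩
  | mul_left x hx W hW ih =>
    obtain ⟨m, hw, hl⟩ := ih
    have hx' : x = a ∨ x = b ∨ x = D ∨ x = star a ∨ x = star b ∨ x = star D := by
      have hs (y : A) (hy : star x = y) : x = star y := by rw [← hy, star_star]
      rcases hx with (hx | hx | hx) | (hx | hx | hx)
      · exact .inl hx
      · exact .inr (.inl hx)
      · exact .inr (.inr (.inl hx))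
      · exact .inr (.inr (.inr (.inl (hs _ hx))))
      · exact .inr (.inr (.inr (.inr (.inl (hs _ hx)))))
      · exact .inr (.inr (.inr (.inr (.inr (hs _ hx)))))
    rcases hx' with rfl | rfl | rfl | rfl | rfl | rfl
    · exact ⟨_, h.hasWeight_a.mul hq hw, hasLeadingTerm_a_mul hl⟩
    · exact ⟨_, by simpa using h.hasWeight_b.mul hq hw,
        hasLeadingTerm_mul_of_tendsto _ (h.tendsto_mul_a_pow hq1 h.b_mul_a_pow) hl⟩
    · exact ⟨_, h.hasWeight_D.mul hq hw, h.hasLeadingTerm_D_mul hl⟩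
    · exact ⟨_, (h.hasWeight_star_a hq).mul hq hw, h.hasLeadingTerm_star_a_mul hq1 hl⟩
    · exact ⟨_, by simpa using h.hasWeight_star_b.mul hq hw,
        hasLeadingTerm_mul_of_tendsto _ (h.tendsto_mul_a_pow (by simpa using hq1)
          h.star_b_mul_a_pow) hl⟩
    · exact ⟨_, (h.hasWeight_star_D hq).mul hq hw, h.hasLeadingTerm_star_D_mul hl⟩

/-- A word of weight zero acts on `aⁿ` asymptotically as a scalar. -/
theorem exists_tendsto_of_hasLeadingTerm_zero (h : GaugedTriple q a b D α) {W : A}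
    (hW : HasLeadingTerm a D 0 W) :
    ∃ c : ℂ, Tendsto (fun n : ℕ => (W - algebraMap ℂ A c) * a ^ n) atTop (𝓝 0) := by
  obtain ⟨i, i', k, k', c, hm, hl⟩ := hW
  have hi : i' = i := by simpa using congrArg Prod.fst hm
  have hk : k' = k := by simpa using congrArg Prod.snd hm
  subst hi hk
  refine ⟨c, ?_⟩
  rw [← tendsto_add_atTop_iff_nat i']
  have := hl.mul_const (star (D ^ k'))
  rw [zero_mul] at this
  have hD : D ^ k' * star (D ^ k') = 1 := by
    rw [star_pow, ← (show Commute D (star D) from h.D_mul_star.trans h.star_mul_D.symm).mul_pow,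
      h.D_mul_star, one_pow]
  refine this.congr fun n => ?_
  rw [sub_mul, smul_mul_assoc, mul_assoc, mul_assoc (a ^ _), hD, mul_one, mul_one, sub_mul,
    Algebra.algebraMap_eq_smul_one, smul_mul_assoc, one_mul]

theorem dense_span_wordMonoid (h : GaugedTriple q a b D α) :
    Dense (Submodule.span ℂ (wordMonoid a b D : Set A) : Set A) := by
  have h1 : (Submodule.span ℂ (wordMonoid a b D : Set A) : Set A)
      = (StarAlgebra.adjoin ℂ {a, b, D} : StarSubalgebra ℂ A) := by
    rw [wordMonoid, ← Algebra.adjoin_eq_span, ← StarAlgebra.adjoin_toSubalgebra]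
    rfl
  rw [h1]
  exact h.dense

end GaugedTriple

/-! ### Spectral projections of the gauge action -/

namespace GaugedTriple

variable {q : ℂ} {A : Type*} [CStarAlgebra A] {a b D : A}
  {α : Circle × Circle → A →⋆ₐ[ℂ] A}

theorem norm_gauge_le (α : Circle × Circle → A →⋆ₐ[ℂ] A) (g : Circle × Circle) (x : A) :
    ‖α g x‖ ≤ ‖x‖ :=
  NonUnitalStarAlgHom.norm_apply_le (α g) x

/-- A single gauge automorphism as a continuous linear map. -/
def gaugeL (α : Circle × Circle → A →⋆ₐ[ℂ] A) (g : Circle × Circle) : A →L[ℂ] A :=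
  LinearMap.mkContinuous (α g).toAlgHom.toLinearMap 1 fun x => by
    rw [one_mul]; exact norm_gauge_le α g x

theorem gaugeL_apply (g : Circle × Circle) (x : A) : gaugeL α g x = α g x := rfl

/-- Words in the generators span a dense subspace, so they determine continuous linear maps. -/
theorem clm_ext {E : Type*} [NormedAddCommGroup E] [NormedSpace ℂ E]
    (h : GaugedTriple q a b D α) {f g : A →L[ℂ] E} (hfg : ∀ W ∈ wordMonoid a b D, f W = g W) :
    f = g :=
  ContinuousLinearMap.ext_on h.dense_span_wordMonoid hfg

variable [Nontrivial A]

theorem continuous_gauge (h : GaugedTriple q a b D α) (hq : q ≠ 0) (hq1 : ‖q‖ < 1) (x : A) :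
    Continuous fun g => α g x := by
  have hs : ∀ p ∈ Submodule.span ℂ (wordMonoid a b D : Set A), Continuous fun g => α g p := by
    intro p hp
    induction hp using Submodule.span_induction with
    | mem W hW =>
      obtain ⟨m, hm, -⟩ := h.exists_hasWeight hq hq1 hW
      simp only [hm.gauge]
      exact (continuous_torusChar m).smul continuous_const
    | zero => simpa using continuous_const
    | add x y _ _ hx hy => simp only [map_add]; fun_prop
    | smul c x _ hx => simp only [map_smul]; fun_prop
  refine continuous_of_uniform_approx_of_continuous fun u hu => ?_
  obtain ⟨ε, hε, hεu⟩ := Metric.mem_uniformity_dist.1 hu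
  obtain ⟨p, hp, hxp⟩ := Metric.dense_iff.1 h.dense_span_wordMonoid x ε hε
  refine ⟨fun g => α g p, hs p hxp, fun g => hεu ?_⟩
  rw [dist_eq_norm, ← map_sub]
  refine (norm_gauge_le α g _).trans_lt ?_
  rw [← dist_eq_norm, dist_comm]
  exact hp

theorem gauge_one (h : GaugedTriple q a b D α) (hq : q ≠ 0) (hq1 : ‖q‖ < 1)
    (x : A) : α 1 x = x := by
  have : gaugeL α 1 = ContinuousLinearMap.id ℂ A := by
    refine h.clm_ext fun W hW => ?_
    obtain ⟨n, hn, -⟩ := h.exists_hasWeight hq hq1 hW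
    simp [gaugeL_apply, hn.gauge, torusChar]
  exact DFunLike.congr_fun this x

theorem gauge_gauge_inv (h : GaugedTriple q a b D α) (hq : q ≠ 0) (hq1 : ‖q‖ < 1)
    (g : Circle × Circle) (x : A) : α g (α g⁻¹ x) = x := by
  have : (gaugeL α g).comp (gaugeL α g⁻¹) = ContinuousLinearMap.id ℂ A := by
    refine h.clm_ext fun W hW => ?_
    obtain ⟨n, hn, -⟩ := h.exists_hasWeight hq hq1 hW
    simp only [ContinuousLinearMap.comp_apply, gaugeL_apply, hn.gauge, map_smul, smul_smul,
      ← torusChar_mul, ContinuousLinearMap.id_apply]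
    simp [torusChar]
  exact DFunLike.congr_fun this x

theorem integrable_gauge (h : GaugedTriple q a b D α) (hq : q ≠ 0) (hq1 : ‖q‖ < 1) (m : ℤ × ℤ)
    (x : A) : Integrable (fun g => torusChar (-m) g • α g x) torusHaar :=
  ((continuous_torusChar (-m)).smul
    (h.continuous_gauge hq hq1 x)).integrable_of_hasCompactSupport
    (HasCompactSupport.of_compactSpace _)

/-- The projection onto the elements of weight `m`: the `m`-th Fourier coefficient of the orbit. -/
def spectralProj (h : GaugedTriple q a b D α) (hq : q ≠ 0) (hq1 : ‖q‖ < 1) (m : ℤ × ℤ) :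
    A →L[ℂ] A :=
  LinearMap.mkContinuous
    { toFun := fun x => ∫ g, torusChar (-m) g • α g x ∂torusHaar
      map_add' := fun x y => by
        simp only [map_add, smul_add]
        exact integral_add (h.integrable_gauge hq hq1 m x) (h.integrable_gauge hq hq1 m y)
      map_smul' := fun c x => by
        simp only [map_smul, smul_comm _ c]
        exact integral_smul c _ } 1 fun x => by
    refine (norm_integral_le_of_norm_le_const (C := ‖x‖) (Eventually.of_forall fun g => ?_)).trans ?_
    · rw [norm_smul, norm_torusChar, one_mul]
      exact norm_gauge_le α g x
    · simp

variable (h : GaugedTriple q a b D α) (hq : q ≠ 0) (hq1 : ‖q‖ < 1)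

theorem spectralProj_apply (m : ℤ × ℤ) (x : A) :
    h.spectralProj hq hq1 m x = ∫ g, torusChar (-m) g • α g x ∂torusHaar := rfl

theorem norm_spectralProj_le (m : ℤ × ℤ) (x : A) : ‖h.spectralProj hq hq1 m x‖ ≤ ‖x‖ := by
  simpa using (LinearMap.mkContinuous_norm_le _ zero_le_one _ :
    ‖h.spectralProj hq hq1 m‖ ≤ 1) |> (h.spectralProj hq hq1 m).le_of_opNorm_le (x := x)

theorem spectralProj_eq_self {m : ℤ × ℤ} {x : A} (hx : ∀ g, α g x = torusChar m g • x) :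
    h.spectralProj hq hq1 m x = x := by
  rw [spectralProj_apply]
  simp [hx, smul_smul, torusChar_neg_mul_self]

theorem spectralProj_eq_zero {m n : ℤ × ℤ} (hmn : m ≠ n) {x : A}
    (hx : ∀ g, α g x = torusChar m g • x) : h.spectralProj hq hq1 n x = 0 := by
  rw [spectralProj_apply]
  simp only [hx, smul_smul, ← torusChar_add]
  rw [integral_smul_const, integral_torusChar, zero_smul]
  rwa [neg_add_eq_sub, sub_ne_zero]

theorem gauge_spectralProj (g : Circle × Circle) (m : ℤ × ℤ) (x : A) :
    α g (h.spectralProj hq hq1 m x) = torusChar m g • h.spectralProj hq hq1 m x := by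
  have : (gaugeL α g).comp (h.spectralProj hq hq1 m)
      = torusChar m g • h.spectralProj hq hq1 m := by
    refine h.clm_ext fun W hW => ?_
    obtain ⟨n, hn, -⟩ := h.exists_hasWeight hq hq1 hW
    by_cases hnm : n = m
    · subst hnm
      simp [h.spectralProj_eq_self hq hq1 hn.gauge, gaugeL_apply, hn.gauge]
    · simp [h.spectralProj_eq_zero hq hq1 hnm hn.gauge]
  exact DFunLike.congr_fun this x

theorem b_mul_spectralProj (m : ℤ × ℤ) (x : A) :
    b * h.spectralProj hq hq1 m x = commFactor q m • (h.spectralProj hq hq1 m x * b) := by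
  have : (ContinuousLinearMap.mul ℂ A b).comp (h.spectralProj hq hq1 m)
      = commFactor q m • ((ContinuousLinearMap.mul ℂ A).flip b).comp (h.spectralProj hq hq1 m) := by
    refine h.clm_ext fun W hW => ?_
    obtain ⟨n, hn, -⟩ := h.exists_hasWeight hq hq1 hW
    by_cases hnm : n = m
    · subst hnm
      simp [h.spectralProj_eq_self hq hq1 hn.gauge, hn.b_mul]
    · simp [h.spectralProj_eq_zero hq hq1 hnm hn.gauge]
  exact DFunLike.congr_fun this x

theorem spectralProj_mem_center {z : A} (hz : z ∈ Subalgebra.center ℂ A) (m : ℤ × ℤ) :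
    h.spectralProj hq hq1 m z ∈ Subalgebra.center ℂ A := by
  rw [Subalgebra.mem_center_iff] at hz ⊢
  intro y
  have hg (g : Circle × Circle) : y * α g z = α g z * y := by
    rw [← h.gauge_gauge_inv hq hq1 g y, ← map_mul, hz, map_mul]
  rw [spectralProj_apply, ← integral_const_mul_of_integrable (h.integrable_gauge hq hq1 m z),
    ← integral_mul_const_of_integrable (h.integrable_gauge hq hq1 m z)]
  simp only [mul_smul_comm, smul_mul_assoc, hg]

/-- An element all of whose Fourier coefficients vanish is zero. -/
theorem eq_zero_of_spectralProj_eq_zero {w : A} (hw : ∀ m, h.spectralProj hq hq1 m w = 0) :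
    w = 0 := by
  by_contra hw0
  obtain ⟨φ, -, hφ⟩ := exists_dual_vector ℂ w (norm_ne_zero_iff.2 hw0)
  have hφw : φ w ≠ 0 := by rw [hφ]; simpa using hw0
  let F : Circle × Circle → ℂ := fun g => φ (α g w)
  have hc (x : A) : Continuous fun g => φ (α g x) := φ.continuous.comp (h.continuous_gauge hq hq1 x)
  have hF : Continuous F := hc w
  have hint (x : A) : Integrable (fun g => star (F g) * φ (α g x)) torusHaar :=
    (hF.star.mul (hc x)).integrable_of_hasCompactSupport (HasCompactSupport.of_compactSpace _)
  -- the functional `x ↦ ⟨F, φ(α(x))⟩` in `L²` of the torus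
  let T : A →L[ℂ] ℂ := LinearMap.mkContinuous
    { toFun := fun x => ∫ g, star (F g) * φ (α g x) ∂torusHaar
      map_add' := fun x y => by
        simp only [map_add, mul_add]
        exact integral_add (hint x) (hint y)
      map_smul' := fun c x => by
        simp only [map_smul, smul_eq_mul, mul_left_comm _ c]
        exact integral_const_mul c _ } (‖φ‖ * ‖w‖ * ‖φ‖) fun x => by
    refine (norm_integral_le_of_norm_le_const (C := ‖φ‖ * ‖w‖ * (‖φ‖ * ‖x‖))
      (Eventually.of_forall fun g => ?_)).trans ?_
    · rw [norm_mul, norm_star]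
      gcongr
      · exact (φ.le_opNorm _).trans (by gcongr; exact norm_gauge_le α g w)
      · exact (φ.le_opNorm _).trans (by gcongr; exact norm_gauge_le α g x)
    · simp [mul_assoc]
  have hT : T = 0 := by
    refine h.clm_ext fun W hW => ?_
    obtain ⟨n, hn, -⟩ := h.exists_hasWeight hq hq1 hW
    have h1 : φ (h.spectralProj hq hq1 n w) = ∫ g, torusChar (-n) g * F g ∂torusHaar := by
      rw [spectralProj_apply, ← φ.integral_comp_comm (h.integrable_gauge hq hq1 n w)]
      simp [F]
    rw [hw, map_zero] at h1
    have h2 : T W = ∫ g, star (torusChar (-n) g * F g) * φ W ∂torusHaar := by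
      change ∫ g, star (F g) * φ (α g W) ∂torusHaar = _
      congr 1
      ext g
      rw [hn.gauge, torusChar_neg, star_mul, star_star, map_smul, smul_eq_mul, mul_assoc]
    rw [h2, integral_mul_const]
    have h3 : ∫ g, star (torusChar (-n) g * F g) ∂torusHaar
        = star (∫ g, torusChar (-n) g * F g ∂torusHaar) := integral_conj
    rw [h3, ← h1]
    simp
  have h4 : ∫ g, ‖F g‖ ^ 2 ∂torusHaar = 0 := by
    have h5 : ∫ g, ((‖F g‖ ^ 2 : ℝ) : ℂ) ∂torusHaar = 0 := by
      have h6 : T w = 0 := by rw [hT]; rfl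
      rw [← h6]
      change _ = ∫ g, star (F g) * F g ∂torusHaar
      congr 1
      ext g
      rw [Complex.star_def, Complex.conj_mul']
      push_cast; rfl
    rw [integral_complex_ofReal] at h5
    exact_mod_cast h5
  have hF2 : Continuous fun g => ‖F g‖ ^ 2 := by fun_prop
  have h7 := (hF2.integral_pos_of_hasCompactSupport_nonneg_nonzero (μ := torusHaar)
    (HasCompactSupport.of_compactSpace _) (fun g => by positivity) (x := 1) ?_).ne'
  · exact h7 h4
  · simpa [F, h.gauge_one hq hq1] using hφw

end GaugedTriple

/-! ### Triviality of the center -/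

theorem star_mem_center {A : Type*} [CStarAlgebra A] {x : A} (hx : x ∈ Subalgebra.center ℂ A) :
    star x ∈ Subalgebra.center ℂ A := by
  rw [Subalgebra.mem_center_iff] at hx ⊢
  intro y
  simpa using congrArg star (hx (star y)).symm

namespace GaugedTriple

variable {q : ℂ} {A : Type*} [CStarAlgebra A] [Nontrivial A] {a b D : A}
  {α : Circle × Circle → A →⋆ₐ[ℂ] A}

/-- The weight-zero component of a polynomial in the generators acts on `aⁿ` asymptotically as a
scalar. -/
theorem exists_tendsto_spectralProj_zero (h : GaugedTriple q a b D α) (hq : q ≠ 0) (hq1 : ‖q‖ < 1)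
    {p : A} (hp : p ∈ Submodule.span ℂ (wordMonoid a b D : Set A)) :
    ∃ c : ℂ, Tendsto (fun n : ℕ => (h.spectralProj hq hq1 0 p - algebraMap ℂ A c) * a ^ n)
      atTop (𝓝 0) := by
  induction hp using Submodule.span_induction with
  | mem W hW =>
    obtain ⟨m, hm, hl⟩ := h.exists_hasWeight hq hq1 hW
    by_cases hm0 : m = 0
    · subst hm0
      rw [h.spectralProj_eq_self hq hq1 hm.gauge]
      exact h.exists_tendsto_of_hasLeadingTerm_zero hl
    · rw [h.spectralProj_eq_zero hq hq1 hm0 hm.gauge]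
      exact ⟨0, by simp⟩
  | zero => exact ⟨0, by simp⟩
  | add x y _ _ hx hy =>
    obtain ⟨c, hc⟩ := hx
    obtain ⟨d, hd⟩ := hy
    refine ⟨c + d, ?_⟩
    have := hc.add hd
    rw [add_zero] at this
    refine this.congr fun n => ?_
    rw [← add_mul, map_add, map_add, add_sub_add_comm]
  | smul r x _ hx =>
    obtain ⟨c, hc⟩ := hx
    refine ⟨r * c, ?_⟩
    have := hc.const_smul r
    rw [smul_zero] at this
    refine this.congr fun n => ?_
    rw [← smul_mul_assoc, map_smul, smul_sub, map_mul, ← Algebra.smul_def]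

/-- A gauge-invariant central element `x` is a scalar: it is approximated by gauge-invariant
polynomials, which act on `aⁿ` as scalars in the limit, and `‖aⁿ (x - c)‖` controls `‖x - c‖`
uniformly in `n`. -/
theorem exists_eq_algebraMap_of_gauge_eq (h : GaugedTriple q a b D α) (hq : q ≠ 0)
    (hq1 : ‖q‖ < 1) {x : A} (hx : x ∈ Subalgebra.center ℂ A) (hg : ∀ g, α g x = x) :
    ∃ c : ℂ, x = algebraMap ℂ A c := by
  suffices hcl : x ∈ closure (Set.range (algebraMap ℂ A)) by
    rw [(algebraMap_isometry ℂ A).isClosedEmbedding.isClosed_range.closure_eq] at hcl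
    obtain ⟨c, hc⟩ := hcl
    exact ⟨c, hc.symm⟩
  rw [Subalgebra.mem_center_iff] at hx
  rw [Metric.mem_closure_range_iff]
  intro ε hε
  obtain ⟨δ, hδ, hδn⟩ := exists_pos_le_prod_one_sub_pow (r := ‖q‖ ^ 2) (by positivity)
    (pow_lt_one₀ (norm_nonneg q) hq1 two_ne_zero)
  have hη : 0 < δ * ε / 2 := by positivity
  obtain ⟨p, hxp, hp⟩ := Metric.dense_iff.1 h.dense_span_wordMonoid x _ hη
  obtain ⟨c, hc⟩ := h.exists_tendsto_spectralProj_zero hq hq1 hp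
  refine ⟨c, ?_⟩
  obtain ⟨n, hn⟩ := ((tendsto_zero_iff_norm_tendsto_zero.1 hc).eventually_lt_const hη).exists
  have hEx : h.spectralProj hq hq1 0 x = x :=
    h.spectralProj_eq_self hq hq1 fun g => by rw [hg, torusChar_zero, one_smul]
  have h1 : ‖(x - h.spectralProj hq hq1 0 p) * a ^ n‖ < δ * ε / 2 := by
    refine ((norm_mul_le _ _).trans
      (mul_le_of_le_one_right (norm_nonneg _) (h.norm_a_pow_le n))).trans_lt ?_
    nth_rewrite 1 [← hEx]
    rw [← map_sub]
    refine (h.norm_spectralProj_le hq hq1 0 _).trans_lt ?_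
    rwa [← dist_eq_norm, dist_comm]
  have h2 : a ^ n * (x - algebraMap ℂ A c) = (x - h.spectralProj hq hq1 0 p) * a ^ n
      + (h.spectralProj hq hq1 0 p - algebraMap ℂ A c) * a ^ n := by
    rw [← add_mul, sub_add_sub_cancel, mul_sub, sub_mul, hx, Algebra.commutes]
  have h3 : δ * ‖x - algebraMap ℂ A c‖ < δ * ε := by
    calc δ * ‖x - algebraMap ℂ A c‖
        ≤ _ := mul_le_mul_of_nonneg_right (hδn n) (norm_nonneg _)
      _ ≤ ‖a ^ n * (x - algebraMap ℂ A c)‖ := h.prod_mul_norm_le hq1 n _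
      _ < δ * ε / 2 + δ * ε / 2 := by
        rw [h2]
        exact (norm_add_le _ _).trans_lt (add_lt_add h1 hn)
      _ = δ * ε := by ring
  rw [dist_eq_norm]
  exact lt_of_mul_lt_mul_left h3 hδ.le

/-- A central element has no components of nonzero weight. If `y` is such a component, then `y`
both commutes and nontrivially `q`-commutes with `b`, so that `y b = 0`; on the other hand `y⋆ y` is
a scalar. -/
theorem spectralProj_eq_zero_of_mem_center (h : GaugedTriple q a b D α) (hq : q ≠ 0)
    (hq1 : ‖q‖ < 1) (hω : ∀ k : ℤ, (q ^ 2 * ((‖q‖ : ℂ) ^ 2)⁻¹) ^ k = 1 → k = 0) (hb : b ≠ 0)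
    {z : A} (hz : z ∈ Subalgebra.center ℂ A) {m : ℤ × ℤ} (hm : m ≠ 0) :
    h.spectralProj hq hq1 m z = 0 := by
  set y := h.spectralProj hq hq1 m z with hy
  have hyc : y ∈ Subalgebra.center ℂ A := h.spectralProj_mem_center hq hq1 hz m
  have hyb : y * b = 0 := by
    have h1 : b * y = commFactor q m • (y * b) := h.b_mul_spectralProj hq hq1 m z
    rw [Subalgebra.mem_center_iff.1 hyc b] at h1
    have h2 : (1 - commFactor q m) • (y * b) = 0 := by rw [sub_smul, one_smul, ← h1, sub_self]
    exact (smul_eq_zero.1 h2).resolve_left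
      (sub_ne_zero.2 (commFactor_ne_one hq hq1.ne hω hm).symm)
  obtain ⟨c, hc⟩ := h.exists_eq_algebraMap_of_gauge_eq hq hq1
    (mul_mem (star_mem_center hyc) hyc) fun g => by
      rw [map_mul, map_star, hy, h.gauge_spectralProj, star_smul, smul_mul_smul_comm,
        ← torusChar_neg, torusChar_neg_mul_self, one_smul]
  have hcb : c • b = 0 := by rw [Algebra.smul_def, ← hc, mul_assoc, hyb, mul_zero]
  rw [(smul_eq_zero.1 hcb).resolve_right hb, map_zero] at hc
  exact CStarRing.star_mul_self_eq_zero_iff y |>.1 hc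

theorem exists_eq_algebraMap_of_mem_center (h : GaugedTriple q a b D α) (hq : q ≠ 0)
    (hq1 : ‖q‖ < 1) (hω : ∀ k : ℤ, (q ^ 2 * ((‖q‖ : ℂ) ^ 2)⁻¹) ^ k = 1 → k = 0) (hb : b ≠ 0)
    {z : A} (hz : z ∈ Subalgebra.center ℂ A) : ∃ c : ℂ, z = algebraMap ℂ A c := by
  obtain ⟨c, hc⟩ := h.exists_eq_algebraMap_of_gauge_eq hq hq1
    (h.spectralProj_mem_center hq hq1 hz 0) fun g => by
      rw [h.gauge_spectralProj, torusChar_zero, one_smul]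
  refine ⟨c, sub_eq_zero.1 (h.eq_zero_of_spectralProj_eq_zero hq hq1 fun m => ?_)⟩
  have hc0 (g : Circle × Circle) : α g (algebraMap ℂ A c) = torusChar 0 g • algebraMap ℂ A c := by
    rw [AlgHomClass.commutes, torusChar_zero, one_smul]
  rw [map_sub]
  by_cases hm : m = 0
  · rw [hm, h.spectralProj_eq_self hq hq1 hc0, hc, sub_self]
  · rw [h.spectralProj_eq_zero_of_mem_center hq hq1 hω hb hz hm,
      h.spectralProj_eq_zero hq hq1 (Ne.symm hm) hc0, sub_self]

end GaugedTriple

/-! ### A representation on `ℓ²(ℕ × ℤ)` -/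

/-- The operator `(T x)(i) = w i * x (f i)` on `ℓ²`, for `f` injective and `|w| ≤ 1`. -/
def weightedComp {ι : Type*} (w : ι → ℂ) (f : ι → ι) (hf : Function.Injective f)
    (hw : ∀ i, ‖w i‖ ≤ 1) :
    lp (fun _ : ι => ℂ) 2 →L[ℂ] lp (fun _ : ι => ℂ) 2 :=
  have key (x : lp (fun _ : ι => ℂ) 2) (s : Finset ι) :
      ∑ i ∈ s, ‖w i * x (f i)‖ ^ (2 : ℝ≥0∞).toReal ≤ ‖x‖ ^ (2 : ℝ≥0∞).toReal := by
    refine le_trans ?_ (lp.sum_rpow_le_norm_rpow (by simp) x (s.map ⟨f, hf⟩))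
    rw [Finset.sum_map]
    refine Finset.sum_le_sum fun i _ => ?_
    rw [norm_mul]
    exact Real.rpow_le_rpow (by positivity)
      (mul_le_of_le_one_left (norm_nonneg _) (hw i)) (by simp)
  LinearMap.mkContinuous
    { toFun := fun x => ⟨fun i => w i * x (f i), memℓp_gen' (key x)⟩
      map_add' := fun x y => lp.ext <| funext fun i => mul_add _ _ _
      map_smul' := fun c x => lp.ext <| funext fun i => mul_left_comm _ _ _ } 1 fun x => by
    rw [one_mul]
    exact lp.norm_le_of_forall_sum_le (by simp) (norm_nonneg _) (key x)

section weightedComp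

variable {ι : Type*} {w : ι → ℂ} {f : ι → ι} (hf : Function.Injective f) (hw : ∀ i, ‖w i‖ ≤ 1)

theorem weightedComp_apply (x : lp (fun _ : ι => ℂ) 2) (i : ι) :
    weightedComp w f hf hw x i = w i * x (f i) := rfl

theorem star_weightedComp_apply [DecidableEq ι] (x : lp (fun _ : ι => ℂ) 2) (j : ι) :
    (star (weightedComp w f hf hw) x : lp (fun _ : ι => ℂ) 2) j
      = inner ℂ (weightedComp w f hf hw (lp.single 2 j 1)) x := by
  have h := lp.inner_single_left (𝕜 := ℂ) (G := fun _ : ι => ℂ) j 1 (star (weightedComp w f hf hw) x)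
  rw [ContinuousLinearMap.star_eq_adjoint, ContinuousLinearMap.adjoint_inner_right] at h
  rw [h, ContinuousLinearMap.star_eq_adjoint]
  simp

theorem star_weightedComp_apply_self (x : lp (fun _ : ι => ℂ) 2) (i : ι) :
    (star (weightedComp w f hf hw) x : lp (fun _ : ι => ℂ) 2) (f i) = star (w i) * x i := by
  classical
  have h : weightedComp w f hf hw (lp.single 2 (f i) 1) = lp.single 2 i (w i) := by
    apply lp.ext
    funext j
    rw [weightedComp_apply, lp.single_apply, lp.single_apply]
    by_cases hj : j = i
    · subst hj; simp
    · simp [hj, hf.ne hj]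
  rw [star_weightedComp_apply, h, lp.inner_single_left]
  simp [mul_comm]

theorem star_weightedComp_apply_of_notMem (x : lp (fun _ : ι => ℂ) 2) {j : ι}
    (hj : ∀ i, f i ≠ j) :
    (star (weightedComp w f hf hw) x : lp (fun _ : ι => ℂ) 2) j = 0 := by
  classical
  have h : weightedComp w f hf hw (lp.single 2 j 1) = 0 := by
    apply lp.ext
    funext i
    rw [weightedComp_apply, lp.single_apply_ne _ _ _ (hj i), mul_zero]
    rfl
  rw [star_weightedComp_apply, h, inner_zero_left]

end weightedComp

/-- For `|q| < 1` the relations hold for operators on `ℓ²(ℕ × ℤ)` with `b ≠ 0`: on the first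
coordinate `a` is a weighted shift and `|b|` the diagonal operator `|q|ⁿ`, while on the second
coordinate the phase of `b` is a shift and `D` is diagonal. -/
theorem exists_uqRelations_b_ne_zero {q : ℂ} (hq : q ≠ 0) (hq1 : ‖q‖ < 1) :
    ∃ a b D : lp (fun _ : ℕ × ℤ => ℂ) 2 →L[ℂ] lp (fun _ : ℕ × ℤ => ℂ) 2,
      UqRelations q a b D ∧ b ≠ 0 := by
  set ω : ℂ := q ^ 2 * ((‖q‖ : ℂ) ^ 2)⁻¹ with hω
  have hω1 : ‖ω‖ = 1 := by
    simp [hω, hq]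
  have hω0 : ω ≠ 0 := by rw [← norm_ne_zero_iff, hω1]; exact one_ne_zero
  have hr (n : ℕ) : (‖q‖ ^ 2) ^ n ≤ 1 := pow_le_one₀ (by positivity)
    (pow_le_one₀ (norm_nonneg q) hq1.le)
  have hqq (n : ℕ) : q ^ n * star q ^ n = (((‖q‖ ^ 2) ^ n : ℝ) : ℂ) := by
    rw [← mul_pow, Complex.star_def, Complex.mul_conj']; push_cast; rfl
  have hωω (k : ℤ) : ω ^ k * star (ω ^ k) = 1 := by
    rw [Complex.star_def, Complex.mul_conj', norm_zpow, hω1]; simp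
  -- the weights of `a`
  let v : ℕ → ℂ := fun n => (Real.sqrt (1 - (‖q‖ ^ 2) ^ (n + 1)) : ℝ)
  have hv (n : ℕ) : v n * v n = 1 - (((‖q‖ ^ 2) ^ (n + 1) : ℝ) : ℂ) := by
    rw [← Complex.ofReal_mul, Real.mul_self_sqrt (sub_nonneg.2 (hr _))]; push_cast; rfl
  have hv' (n : ℕ) : star (v n) = v n := Complex.conj_ofReal _
  have hv1 (n : ℕ) : ‖v n‖ ≤ 1 := by
    rw [Complex.norm_real, Real.norm_of_nonneg (Real.sqrt_nonneg _)]
    exact Real.sqrt_le_one.2 (sub_le_self _ (by positivity))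
  have injA : Function.Injective fun p : ℕ × ℤ => (p.1 + 1, p.2) := fun p p' h => by
    simpa [Prod.ext_iff] using h
  have injB : Function.Injective fun p : ℕ × ℤ => (p.1, p.2 - 1) := fun p p' h => by
    simpa [Prod.ext_iff] using h
  let aS := weightedComp (fun p : ℕ × ℤ => v p.1) _ injA fun p => hv1 _
  let b := weightedComp (fun p : ℕ × ℤ => q ^ p.1) _ injB fun p => by
    rw [norm_pow]; exact pow_le_one₀ (norm_nonneg q) hq1.le
  let D := weightedComp (fun p : ℕ × ℤ => ω ^ (-p.2)) id Function.injective_id fun p => by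
    rw [norm_zpow, hω1, one_zpow]
  have haS (x n k) : (aS x) (n, k) = v n * x (n + 1, k) := rfl
  have ha0 (x k) : (star aS x) (0, k) = 0 :=
    star_weightedComp_apply_of_notMem _ _ _ fun i => by simp
  have ha (x n k) : (star aS x) (n + 1, k) = v n * x (n, k) := by
    rw [← hv']; exact star_weightedComp_apply_self injA _ x (n, k)
  have hb (x n k) : (b x) (n, k) = q ^ n * x (n, k - 1) := rfl
  have hbS (x n k) : (star b x) (n, k) = star q ^ n * x (n, k + 1) := by
    have := star_weightedComp_apply_self injB (w := fun p : ℕ × ℤ => q ^ p.1) (fun p => by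
      rw [norm_pow]; exact pow_le_one₀ (norm_nonneg q) hq1.le) x (n, k + 1)
    simpa using this
  have hD (x n k) : (D x) (n, k) = ω ^ (-k) * x (n, k) := rfl
  have hDS (x n k) : (star D x) (n, k) = star (ω ^ (-k)) * x (n, k) :=
    star_weightedComp_apply_self Function.injective_id _ x (n, k)
  have ext2 {S T : lp (fun _ : ℕ × ℤ => ℂ) 2 →L[ℂ] lp (fun _ : ℕ × ℤ => ℂ) 2}
      (h0 : ∀ x n k, (S x) (n, k) = (T x) (n, k)) : S = T :=
    ContinuousLinearMap.ext fun x => lp.ext <| funext fun p => h0 x p.1 p.2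
  refine ⟨star aS, b, D, ⟨?_, ?_, ?_, ?_, ?_, ?_, ?_, ?_, ?_⟩, ?_⟩
  · refine ext2 fun x n k => ?_
    change (b (star aS x)) (n, k) = q * (star aS (b x)) (n, k)
    rw [hb]
    cases n with
    | zero => rw [ha0, ha0, mul_zero, mul_zero]
    | succ n => rw [ha, ha, hb]; ring
  · rw [star_star]
    refine ext2 fun x n k => ?_
    change (aS (b x)) (n, k) = q * (b (aS x)) (n, k)
    rw [haS, hb, hb, haS]; ring
  · refine ext2 fun x n k => ?_
    change (b (star b x)) (n, k) = (star b (b x)) (n, k)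
    rw [hb, hbS, hbS, hb, sub_add_cancel, add_sub_cancel_right]; ring
  · rw [star_star]
    refine ext2 fun x n k => ?_
    change (star aS (aS x)) (n, k) + (b (star b x)) (n, k) = x (n, k)
    rw [hb, hbS, sub_add_cancel, ← mul_assoc, hqq]
    cases n with
    | zero => rw [ha0]; simp
    | succ n => rw [ha, haS, ← mul_assoc, hv]; ring
  · refine ext2 fun x n k => ?_
    change (star aS (D x)) (n, k) = (D (star aS x)) (n, k)
    rw [hD]
    cases n with
    | zero => rw [ha0, ha0, mul_zero]
    | succ n => rw [ha, ha, hD]; ring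
  · refine ext2 fun x n k => ?_
    change (b (D x)) (n, k) = ω * (D (b x)) (n, k)
    have h1 : ω ^ (-(k - 1)) = ω * ω ^ (-k) := by rw [← zpow_one_add₀ hω0]; congr 1; ring
    rw [hb, hD, hD, hb, h1]; ring
  · refine ext2 fun x n k => ?_
    change (D (star D x)) (n, k) = x (n, k)
    rw [hD, hDS, ← mul_assoc, hωω, one_mul]
  · refine ext2 fun x n k => ?_
    change (star D (D x)) (n, k) = x (n, k)
    rw [hDS, hD, ← mul_assoc, mul_comm (star _), hωω, one_mul]
  · rw [star_star]
    refine ext2 fun x n k => ?_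
    change (aS (star aS x)) (n, k) + ((‖q‖ : ℂ) ^ 2) * (star b (b x)) (n, k) = x (n, k)
    rw [haS, ha, hbS, hb, add_sub_cancel_right, ← mul_assoc, hv, ← mul_assoc (star q ^ n),
      mul_comm (star q ^ n), hqq]
    push_cast; ring
  · intro h0
    have h1 := hb (lp.single 2 (0, -1) 1) 0 0
    rw [h0] at h1
    simp at h1

/-! ### The universal C⋆-algebras -/

/-- Elements with the universal property generate a dense subalgebra. -/
theorem dense_adjoin_of_universal {q : ℂ} {A : Type u} [CStarAlgebra A] {a b D : A}
    (h : UqRelations q a b D)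
    (hex : ∀ (B : Type u) [CStarAlgebra B] {x y z : B}, UqRelations q x y z →
      ∃ φ : A →⋆ₐ[ℂ] B, φ a = x ∧ φ b = y ∧ φ D = z)
    (hext : ∀ φ : A →⋆ₐ[ℂ] A, φ a = a → φ b = b → φ D = D → φ = StarAlgHom.id ℂ A) :
    Dense (StarAlgebra.adjoin ℂ {a, b, D} : Set A) := by
  let S := (StarAlgebra.adjoin ℂ {a, b, D}).topologicalClosure
  let _ : CStarAlgebra S := StarSubalgebra.cstarAlgebra S
    (h_closed := StarSubalgebra.isClosed_topologicalClosure _)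
  have hsub : {a, b, D} ⊆ (S : Set A) :=
    (StarAlgebra.subset_adjoin ℂ _).trans (StarSubalgebra.le_topologicalClosure _)
  have hrel : UqRelations q (⟨a, hsub (by simp)⟩ : S) ⟨b, hsub (by simp)⟩
      ⟨D, hsub (by simp)⟩ := by
    constructor <;> apply Subtype.ext
    · exact h.b_mul_a
    · exact h.star_a_mul_b
    · exact h.b_normal
    · exact h.sum_one
    · exact h.a_comm_D
    · exact h.b_mul_D
    · exact h.D_mul_star
    · exact h.star_mul_D
    · exact h.sum_one'
  obtain ⟨φ, ha, hb, hD⟩ := hex S hrel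
  have h1 : S.subtype.comp φ = StarAlgHom.id ℂ A :=
    hext _ (congrArg Subtype.val ha) (congrArg Subtype.val hb) (congrArg Subtype.val hD)
  intro x
  have hx : ((φ x : S) : A) = x := DFunLike.congr_fun h1 x
  rw [← StarSubalgebra.topologicalClosure_coe, ← hx]
  exact (φ x).2

namespace CUq

/-- For `|q| < 1` this holds by the representation on `ℓ²(ℕ × ℤ)`, and for `|q| > 1` by the
representation for `q⁻¹`, since `q` and `q⁻¹` are interchangeable. -/
theorem b_ne_zero {q : ℂ} (hq : q ≠ 0) (hq1 : ‖q‖ ≠ 1) : b q ≠ 0 := by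
  have key {H : Type} [CStarAlgebra H] {x y z : H} (h : UqRelations q x y z) (hy : y ≠ 0) :
      b q ≠ 0 := by
    obtain ⟨φ, ⟨-, hφ, -⟩, -⟩ := existsUnique_hom h
    intro h0
    rw [h0, map_zero] at hφ
    exact hy hφ.symm
  rcases hq1.lt_or_gt with hlt | hgt
  · obtain ⟨x, y, z, h, hy⟩ := exists_uqRelations_b_ne_zero hq hlt
    exact key h hy
  · obtain ⟨x, y, z, h, hy⟩ := exists_uqRelations_b_ne_zero (inv_ne_zero hq)
      (by rw [norm_inv]; exact inv_lt_one_of_one_lt₀ hgt)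
    have h' := h.inv (inv_ne_zero hq)
    rw [inv_inv] at h'
    exact key h' (smul_ne_zero (inv_ne_zero hq) hy)

theorem dense_adjoin (q : ℂ) :
    Dense (StarAlgebra.adjoin ℂ {a q, b q, D q} : Set (CUq q)) :=
  dense_adjoin_of_universal (relations q) (fun _ _ _ _ _ h => (existsUnique_hom h).exists)
    fun _ ha hb hD => hom_ext ha hb hD

theorem uqRelations_smul {q : ℂ} {A : Type*} [CStarAlgebra A] {x y z : A}
    (h : UqRelations q x y z) (s t : Circle) : UqRelations q ((s : ℂ) • x) y ((t : ℂ) • z) := by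
  have hc (u : Circle) : (u : ℂ) * star (u : ℂ) = 1 := by
    rw [Complex.star_def, ← Circle.coe_inv_eq_conj, ← Circle.coe_mul, mul_inv_cancel,
      Circle.coe_one]
  have hc' (u : Circle) : star (u : ℂ) * (u : ℂ) = 1 := (mul_comm _ _).trans (hc u)
  refine ⟨?_, ?_, h.b_normal, ?_, ?_, ?_, ?_, ?_, ?_⟩
  · rw [mul_smul_comm, smul_mul_assoc, h.b_mul_a, smul_comm]
  · rw [star_smul, smul_mul_assoc, mul_smul_comm, h.star_a_mul_b, smul_comm]
  · rw [star_smul, smul_mul_smul_comm, hc, one_smul, h.sum_one]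
  · rw [smul_mul_smul_comm, smul_mul_smul_comm, h.a_comm_D, mul_comm]
  · rw [mul_smul_comm, smul_mul_assoc, h.b_mul_D, smul_comm]
  · rw [star_smul, smul_mul_smul_comm, hc, one_smul, h.D_mul_star]
  · rw [star_smul, smul_mul_smul_comm, hc', one_smul, h.star_mul_D]
  · rw [star_smul, smul_mul_smul_comm, hc', one_smul, h.sum_one']

theorem exists_gaugedTriple (q : ℂ) :
    ∃ α : Circle × Circle → CUq q →⋆ₐ[ℂ] CUq q, GaugedTriple q (a q) (b q) (D q) α := by
  choose α hα _ using fun g : Circle × Circle =>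
    existsUnique_hom (uqRelations_smul (relations q) g.1 g.2)
  exact ⟨α, relations q, dense_adjoin q, fun g => (hα g).1, fun g => (hα g).2.1,
    fun g => (hα g).2.2⟩

end CUq

/-- The substitution interchanging `q` and `q⁻¹` inverts the gauge action. -/
theorem GaugedTriple.inv {q : ℂ} (hq : q ≠ 0) {A : Type*} [CStarAlgebra A] {a b D : A}
    {α : Circle × Circle → A →⋆ₐ[ℂ] A} (h : GaugedTriple q a b D α) :
    GaugedTriple q⁻¹ (star a) (q • b) (star D) fun g => α g⁻¹ where
  toUqRelations := h.toUqRelations.inv hq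
  dense := by
    have hsub := StarAlgebra.subset_adjoin ℂ {star a, q • b, star D}
    have ha := hsub (show star a ∈ _ by simp)
    have hb := hsub (show q • b ∈ _ by simp)
    have hD := hsub (show star D ∈ _ by simp)
    refine h.dense.mono (StarAlgebra.adjoin_le ?_)
    rintro x (rfl | rfl | rfl)
    · simpa only [star_star, SetLike.mem_coe] using star_mem (SetLike.mem_coe.1 ha)
    · have := SMulMemClass.smul_mem q⁻¹ (SetLike.mem_coe.1 hb)
      rwa [inv_smul_smul₀ hq] at this
    · simpa only [star_star, SetLike.mem_coe] using star_mem (SetLike.mem_coe.1 hD)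
  map_a g := by
    rw [map_star, h.map_a, star_smul, Complex.star_def, ← Circle.coe_inv_eq_conj, Prod.fst_inv,
      inv_inv]
  map_b g := by rw [map_smul, h.map_b]
  map_D g := by
    rw [map_star, h.map_D, star_smul, Complex.star_def, ← Circle.coe_inv_eq_conj, Prod.snd_inv,
      inv_inv]

namespace CUq

theorem exists_eq_algebraMap_of_mem_center {q : ℂ} (hq : q ≠ 0) (hq1 : ‖q‖ ≠ 1)
    (hω : ∀ k : ℤ, (q ^ 2 * ((‖q‖ : ℂ) ^ 2)⁻¹) ^ k = 1 → k = 0)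
    {z : CUq q} (hz : z ∈ Subalgebra.center ℂ (CUq q)) :
    ∃ c : ℂ, z = algebraMap ℂ (CUq q) c := by
  obtain ⟨α, h⟩ := exists_gaugedTriple q
  have hb := b_ne_zero hq hq1
  have : Nontrivial (CUq q) := ⟨_, _, hb⟩
  rcases hq1.lt_or_gt with hlt | hgt
  · exact h.exists_eq_algebraMap_of_mem_center hq hlt hω hb hz
  · refine (h.inv hq).exists_eq_algebraMap_of_mem_center (inv_ne_zero hq)
      (by rw [norm_inv]; exact inv_lt_one_of_one_lt₀ hgt) (fun k hk => hω k ?_)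
      (smul_ne_zero hq hb) hz
    have e : q⁻¹ ^ 2 * ((‖q⁻¹‖ : ℂ) ^ 2)⁻¹ = (q ^ 2 * ((‖q‖ : ℂ) ^ 2)⁻¹)⁻¹ := by
      rw [norm_inv]; push_cast; simp [mul_comm]
    rwa [e, inv_zpow, inv_eq_one] at hk

/-- For real `q` the generator `D` is central. -/
theorem D_mem_center {q : ℝ} (hq : q ≠ 0) : D (q : ℂ) ∈ Subalgebra.center ℂ (CUq (q : ℂ)) := by
  have h := relations (q : ℂ)
  have h1 : ((q : ℂ) ^ 2 * ((‖(q : ℂ)‖ : ℂ) ^ 2)⁻¹) = 1 := by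
    have hq' : ((q : ℂ) ^ 2) ≠ 0 := by simpa using hq
    rw [Complex.norm_real, Real.norm_eq_abs, ← Complex.ofReal_pow |q|, sq_abs, Complex.ofReal_pow,
      mul_inv_cancel₀ hq']
  have hbD : b (q : ℂ) * D q = D q * b q := by rw [h.b_mul_D, h1, one_smul]
  -- conjugation by `D` fixes the generators
  let Φ : CUq (q : ℂ) →⋆ₐ[ℂ] CUq (q : ℂ) :=
    { toFun := fun x => D q * x * star (D q)
      map_one' := by rw [mul_one, h.D_mul_star]
      map_mul' := fun x y => by
        calc D q * (x * y) * star (D q)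
            = D q * x * (star (D q) * D q) * y * star (D q) := by
              rw [h.star_mul_D, mul_one]; simp only [mul_assoc]
          _ = _ := by simp only [mul_assoc]
      map_zero' := by simp
      map_add' := fun x y => by rw [mul_add, add_mul]
      commutes' := fun r => by
        rw [← Algebra.commutes, mul_assoc, h.D_mul_star, mul_one]
      map_star' := fun x => by simp [mul_assoc] }
  have hΦ : Φ = StarAlgHom.id ℂ _ := by
    refine hom_ext ?_ ?_ ?_
    · change D q * a q * star (D q) = a q
      rw [← h.a_comm_D, mul_assoc, h.D_mul_star, mul_one]
    · change D q * b q * star (D q) = b q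
      rw [← hbD, mul_assoc, h.D_mul_star, mul_one]
    · change D q * D q * star (D q) = D q
      rw [mul_assoc, h.D_mul_star, mul_one]
  rw [Subalgebra.mem_center_iff]
  intro x
  have hx : D q * x * star (D q) = x := DFunLike.congr_fun hΦ x
  calc x * D q = D q * x * star (D q) * D q := by rw [hx]
    _ = D q * x := by rw [mul_assoc, h.star_mul_D, mul_one]

/-- `D` is not a scalar: it takes the values `1` and `-1` on characters. -/
theorem D_ne_algebraMap (q : ℂ) (c : ℂ) : D q ≠ algebraMap ℂ (CUq q) c := by
  intro hD
  have key (s : ℂ) (hs : s * star s = 1) : s = c := by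
    have h : UqRelations q (1 : ℂ) 0 s := by
      constructor <;> simp_all [mul_comm]
    obtain ⟨φ, ⟨-, -, hφ⟩, -⟩ := existsUnique_hom h
    rw [hD, AlgHomClass.commutes] at hφ
    exact hφ.symm
  have h1 := (key 1 (by simp)).trans (key (-1) (by simp)).symm
  norm_num at h1

end CUq

/-- The square of the phase of `q` is `exp (2 i arg q)`, a root of unity only if `arg q` is a
rational multiple of `π`. -/
theorem eq_zero_of_phase_zpow_eq_one {q : ℂ} (hq : q ≠ 0)
    (hθ : Irrational (Complex.arg q / Real.pi)) {k : ℤ}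
    (hk : (q ^ 2 * ((‖q‖ : ℂ) ^ 2)⁻¹) ^ k = 1) : k = 0 := by
  by_contra hk0
  have hn : (‖q‖ : ℂ) ^ 2 ≠ 0 := by simp [hq]
  have h1 : q ^ 2 * ((‖q‖ : ℂ) ^ 2)⁻¹ = Complex.exp (2 * (Complex.arg q * Complex.I)) := by
    conv_lhs => enter [1]; rw [← Complex.norm_mul_exp_arg_mul_I q, mul_pow]
    rw [two_mul, Complex.exp_add, mul_comm, inv_mul_cancel_left₀ hn, sq]
  rw [h1, ← Complex.exp_int_mul, Complex.exp_eq_one_iff] at hk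
  obtain ⟨n, hn⟩ := hk
  have h2 : (k : ℝ) * Complex.arg q = n * Real.pi := by
    have h3 : ((k * Complex.arg q : ℝ) : ℂ) * (2 * Complex.I)
        = ((n * Real.pi : ℝ) : ℂ) * (2 * Complex.I) := by
      push_cast
      linear_combination hn
    exact_mod_cast mul_right_cancel₀ (by simp) h3
  refine hθ ⟨(n : ℚ) / k, ?_⟩
  have hk' : (k : ℝ) ≠ 0 := by exact_mod_cast hk0
  push_cast
  rw [div_eq_div_iff hk' Real.pi_ne_zero]
  linarith

theorem theorem3p1 (q : ℂ) (hq : q.im ≠ 0) (hq1 : ‖q‖ ≠ 1)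
    (hθ : Irrational (Complex.arg q / Real.pi)) (q' : ℝ) (hq' : q' ≠ 0) :
    IsEmpty (CUq q ≃⋆ₐ[ℂ] CUq (q' : ℂ)) := by
  refine ⟨fun e => ?_⟩
  have hq0 : q ≠ 0 := by rintro rfl; exact hq Complex.zero_im
  have hD := Subalgebra.mem_center_iff.1 (CUq.D_mem_center hq')
  have hz : e.symm (CUq.D q') ∈ Subalgebra.center ℂ (CUq q) := by
    rw [Subalgebra.mem_center_iff]
    intro x
    apply EquivLike.injective e
    rw [map_mul, map_mul, e.apply_symm_apply, hD]
  obtain ⟨c, hc⟩ := CUq.exists_eq_algebraMap_of_mem_center hq0 hq1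
    (fun k hk => eq_zero_of_phase_zpow_eq_one hq0 hθ hk) hz
  refine CUq.D_ne_algebraMap q' c ?_
  rw [← e.apply_symm_apply (CUq.D q'), hc]
  exact AlgHomClass.commutes e c

end
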